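/- Let $n\ge 1$ and let $G=SO(2n+1)$ (the classical model of the compact connected simple Lie group of type $B_n$) with Haar probability measure $m_G$. Let $T_n\subset G$ be the maximal torus of block diagonal matrices with $n$ blocks $\begin{pmatrix}\cos\theta_j&-\sin\theta_j\\ \sin\theta_j&\cos\theta_j\end{pmatrix}$ followed by a final $1\times1$ block $1$; identify such an element with the vector $(e^{i\theta_1},\dots,e^{i\theta_n})$. For $x\in T_n$ let $\mu_x$ be the orbital measure on the conjugacy class of $x$, $\int_G f\,d\mu_x=\int_G f(gxg^{-1})\,dm_G(g)$ for continuous $f$. Call $(x_1,\dots,x_L)\in T_n^L$ absolutely continuous if $\mu_{x_1}*\cdots*\mu_{x_L}$ is absolutely continuous with respect to $m_G$. For $x\in T_n$ let $u$ be the number of entries of its vector equal to $1$, $v$ the number of entries equal to $-1$, and $s$ the maximum over $0<a<\pi$ of the number of entries in $\{e^{ia},e^{-ia}\}$. Then $x$ is of exactly one dominant type: - type $B$ if $u>v$ and $2u+1>s$, and then $S_x=2u+1$; - type $D$ if $v>u$ and $2v>s$, and then $S_x=2v$; - type $BD$ if $u=v$ and $2v\ge s$, and then $S_x^{(1)}=2u+1$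 and $S_x^{(2)}=2v$; - type $S$ if $s\ge 2u+1$ and $s\ge 2v$, and then $S_x=s$. The parity $p$ of $(x_1,\dots,x_L)$ is $1$ if an odd number of the $x_j$ are of dominant type $D$, and $2$ otherwise. The tuple is eligible if one of the following holds: (i) at least two of the $x_j$ are of dominant type $BD$ or $S$; (ii) exactly one $x_j$ is of dominant type $S$, none is of dominant type $BD$, and $\sum_{i=1}^L S_{x_i}\le(2n+1)(L-1)$; (iii) exactly one $x_j$ is of dominant type $BD$, none is of dominant type $S$, and $S_{x_j}^{(p)}+\sum_{i\ne j}S_{x_i}\le(2n+1)(L-1)$; (iv) no $x_j$ is of dominant type $BD$ or $S$, and $\sum_{i=1}^L S_{x_i}\le(2n+1)(L-1)+p-1$. **Proposition.** Every absolutely continuous tuple $(x_1,\dots,x_L)\in T_n^L$ is eligible. -/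

import Mathlib

open MeasureTheory

noncomputable section

/-! ### The group `SO(2n+1)` with its normalised Haar measure -/

/-- The index set of the `2n+1` coordinates: `n` pairs of coordinates `(0, j), (1, j)`, one pair
for each `2 × 2` block, and one final coordinate. -/
abbrev CoordIdx (n : ℕ) : Type := (Fin 2 × Fin n) ⊕ Unit

/-- `CoordIdx n` has `2n+1` elements. -/
theorem card_coordIdx (n : ℕ) : Fintype.card (CoordIdx n) = 2 * n + 1 := by
  simp [CoordIdx]

/-- The compact Lie group of type `B_n`: real orthogonal matrices of size `2n+1`, determinant `1`. -/
abbrev SOdd (n : ℕ) : Type := Matrix.specialOrthogonalGroup (CoordIdx n) ℝ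

namespace SOdd

variable {n : ℕ}

theorem transpose_mul_self (g : SOdd n) :
    (g : Matrix (CoordIdx n) (CoordIdx n) ℝ).transpose *
      (g : Matrix (CoordIdx n) (CoordIdx n) ℝ) = 1 :=
  g.2.1.1

theorem coe_inv (g : SOdd n) :
    ((g⁻¹ : SOdd n) : Matrix (CoordIdx n) (CoordIdx n) ℝ) =
      (g : Matrix (CoordIdx n) (CoordIdx n) ℝ).transpose := rfl

instance : IsTopologicalGroup (SOdd n) where
  continuous_inv := by
    refine Continuous.subtype_mk ?_ _
    exact continuous_subtype_val.matrix_transpose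

theorem mem_iff (A : Matrix (CoordIdx n) (CoordIdx n) ℝ) :
    A ∈ Matrix.specialOrthogonalGroup (CoordIdx n) ℝ ↔ A.transpose * A = 1 ∧ A.det = 1 := by
  rw [Matrix.mem_specialOrthogonalGroup_iff, Matrix.mem_orthogonalGroup_iff']

theorem abs_entry_le_one {A : Matrix (CoordIdx n) (CoordIdx n) ℝ} (hA : A.transpose * A = 1)
    (i j : CoordIdx n) : A i j ∈ Set.Icc (-1 : ℝ) 1 := by
  have h : ∑ k, A k j * A k j = 1 := by
    have := congrFun (congrFun hA j) j
    simpa [Matrix.mul_apply] using this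
  have h2 : A i j * A i j ≤ ∑ k, A k j * A k j :=
    Finset.single_le_sum (f := fun k => A k j * A k j) (fun k _ => mul_self_nonneg _)
      (Finset.mem_univ i)
  constructor <;> nlinarith

instance : CompactSpace (SOdd n) := by
  refine isCompact_iff_compactSpace.mp ?_
  have hbox : IsCompact (X := Matrix (CoordIdx n) (CoordIdx n) ℝ)
      (Set.univ.pi fun _ => Set.univ.pi fun _ => Set.Icc (-1 : ℝ) 1) :=
    isCompact_univ_pi (X := fun _ : CoordIdx n => CoordIdx n → ℝ)
      fun _ => isCompact_univ_pi fun _ => isCompact_Icc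
  refine hbox.of_isClosed_subset ?_ ?_
  · have : (Matrix.specialOrthogonalGroup (CoordIdx n) ℝ :
        Set (Matrix (CoordIdx n) (CoordIdx n) ℝ)) =
        {A | A.transpose * A = 1} ∩ {A | A.det = 1} := by
      ext A
      exact mem_iff A
    rw [this]
    refine IsClosed.inter (isClosed_eq ?_ continuous_const) (isClosed_eq ?_ continuous_const)
    · exact continuous_id.matrix_transpose.matrix_mul continuous_id
    · exact continuous_id.matrix_det
  · intro A hA i _ j _
    exact abs_entry_le_one ((mem_iff A).1 hA).1 i j

instance : SecondCountableTopology (SOdd n) := by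
  have : SecondCountableTopology (Matrix (CoordIdx n) (CoordIdx n) ℝ) :=
    inferInstanceAs (SecondCountableTopology (CoordIdx n → CoordIdx n → ℝ))
  exact TopologicalSpace.Subtype.secondCountableTopology _

instance : MeasurableSpace (SOdd n) := borel _

instance : BorelSpace (SOdd n) := ⟨rfl⟩

/-- The Haar probability measure `m_G` of `G = SO(2n+1)`. -/
def haar (n : ℕ) : Measure (SOdd n) := Measure.haarMeasure ⊤

instance : IsProbabilityMeasure (haar n) :=
  ⟨by
    have h := Measure.haarMeasure_self (K₀ := (⊤ : TopologicalSpace.PositiveCompacts (SOdd n)))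
    simpa [haar] using h⟩

end SOdd

/-! ### The maximal torus -/

/-- The maximal torus `T_n`: the element with parameters `(e^{iθ_1}, …, e^{iθ_n})` is identified
with that vector. -/
abbrev TorusB (n : ℕ) : Type := Fin n → Circle

namespace TorusB

variable {n : ℕ}

/-- The `2 × 2` block `[[cos θ, -sin θ], [sin θ, cos θ]]` for `z = e^{iθ}`. -/
def rotBlock (z : Circle) : Matrix (Fin 2) (Fin 2) ℝ :=
  !![(z : ℂ).re, -(z : ℂ).im; (z : ℂ).im, (z : ℂ).re]

theorem rotBlock_exp (θ : ℝ) :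
    rotBlock (Circle.exp θ) = !![Real.cos θ, -Real.sin θ; Real.sin θ, Real.cos θ] := by
  simp [rotBlock, Circle.coe_exp, Complex.exp_ofReal_mul_I_re, Complex.exp_ofReal_mul_I_im]

theorem re_sq_add_im_sq (z : Circle) : (z : ℂ).re * (z : ℂ).re + (z : ℂ).im * (z : ℂ).im = 1 := by
  have := Circle.normSq_coe z
  rwa [Complex.normSq_apply] at this

theorem rotBlock_transpose_mul (z : Circle) : (rotBlock z).transpose * rotBlock z = 1 := by
  have h := re_sq_add_im_sq z
  ext i j
  fin_cases i <;> fin_cases j <;> simp [rotBlock, Matrix.mul_apply, Fin.sum_univ_two] <;> linarith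

theorem rotBlock_det (z : Circle) : (rotBlock z).det = 1 := by
  have h := re_sq_add_im_sq z
  simp [rotBlock, Matrix.det_fin_two]
  linarith

/-- The block diagonal matrix with blocks `rotBlock (x j)` and a final `1 × 1` block `1`. -/
def toMatrix (x : TorusB n) : Matrix (CoordIdx n) (CoordIdx n) ℝ :=
  Matrix.fromBlocks (Matrix.blockDiagonal fun j => rotBlock (x j)) 0 0 1

/-- The torus element as an element of `SO(2n+1)`. -/
def toSO (x : TorusB n) : SOdd n :=
  ⟨toMatrix x, by
    rw [SOdd.mem_iff]
    constructor
    · rw [toMatrix, Matrix.fromBlocks_transpose, Matrix.fromBlocks_multiply,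
        Matrix.blockDiagonal_transpose, ← Matrix.blockDiagonal_mul]
      simp only [rotBlock_transpose_mul]
      have h : (Matrix.blockDiagonal fun _ : Fin n => (1 : Matrix (Fin 2) (Fin 2) ℝ)) = 1 :=
        Matrix.blockDiagonal_one
      simp [h]
    · rw [toMatrix, Matrix.det_fromBlocks_zero₂₁, Matrix.det_blockDiagonal]
      simp [rotBlock_det]⟩

/-! ### Orbital measures -/

/-- The orbital measure `μ_x`: the image of `m_G` under `g ↦ g x g⁻¹`, that is
`∫ f dμ_x = ∫ f (g x g⁻¹) dm_G(g)`. -/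
def orbitalMeasure (x : TorusB n) : Measure (SOdd n) :=
  (SOdd.haar n).map fun g => g * x.toSO * g⁻¹

/-- The convolution `μ_{x_1} * ⋯ * μ_{x_L}` (the unit mass at the identity when `L = 0`). -/
def convOrbital {L : ℕ} (x : Fin L → TorusB n) : Measure (SOdd n) :=
  (List.ofFn fun i => (x i).orbitalMeasure).foldr Measure.mconv (Measure.dirac 1)

/-- The tuple `(x_1, …, x_L)` is absolutely continuous. -/
def IsAbsCont {L : ℕ} (x : Fin L → TorusB n) : Prop :=
  convOrbital x ≪ SOdd.haar n

/-! ### Type and dominant type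

An element `x` of the torus is conjugate in `SO(2n+1)` to one whose vector has `u` entries `1`,
`v` entries `-1`, and `s_ℓ` entries `e^{i a_ℓ}` with distinct `0 < a_ℓ < π`. The conjugations
permute the entries of the vector and replace some of them by their inverses, so that `u`, `v` and
the `s_ℓ` are the numbers below. -/

/-- `u`: the number of entries equal to `1`. -/
def u (x : TorusB n) : ℕ := Nat.card {j // x j = 1}

/-- `v`: the number of entries equal to `-1`. -/
def v (x : TorusB n) : ℕ := Nat.card {j // (x j : ℂ) = -1}

/-- The number of entries equal to `z` or to `z⁻¹` (that is, `s_ℓ` for `z = e^{± i a_ℓ}`). -/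
def mult (x : TorusB n) (z : Circle) : ℕ := Nat.card {j // x j = z ∨ x j = z⁻¹}

open Classical in
/-- `s = max s_ℓ`, which is `0` when all entries are `± 1`. -/
def s (x : TorusB n) : ℕ :=
  (Finset.univ.filter fun j => x j ≠ 1 ∧ (x j : ℂ) ≠ -1).sup fun j => x.mult (x j)

end TorusB

/-- The four dominant types. -/
inductive DominantType : Type
  | B
  | D
  | BD
  | S

namespace TorusB

variable {n : ℕ}

/-- The criterion for `x` to be of a given dominant type. -/
def HasDominantType (x : TorusB n) : DominantType → Prop
  | .B => x.v < x.u ∧ x.s < 2 * x.u + 1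
  | .D => x.u < x.v ∧ x.s < 2 * x.v
  | .BD => x.v = x.u ∧ x.s ≤ 2 * x.v
  | .S => 2 * x.u + 1 ≤ x.s ∧ 2 * x.v ≤ x.s

/-- Each `x` satisfies precisely one of the four criteria. -/
theorem existsUnique_hasDominantType (x : TorusB n) : ∃! t, x.HasDominantType t := by
  have key : ∀ t t', x.HasDominantType t → x.HasDominantType t' → t = t' := by
    intro t t' h h'
    cases t <;> cases t' <;> simp only [HasDominantType] at h h' <;> first | rfl | omega
  by_cases hS : 2 * x.u + 1 ≤ x.s ∧ 2 * x.v ≤ x.s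
  · exact ⟨.S, hS, fun t ht => key _ _ ht hS⟩
  · rcases lt_trichotomy x.u x.v with h | h | h
    · have hD : x.HasDominantType .D := ⟨h, by omega⟩
      exact ⟨.D, hD, fun t ht => key _ _ ht hD⟩
    · have hBD : x.HasDominantType .BD := ⟨h.symm, by omega⟩
      exact ⟨.BD, hBD, fun t ht => key _ _ ht hBD⟩
    · have hB : x.HasDominantType .B := ⟨h, by omega⟩
      exact ⟨.B, hB, fun t ht => key _ _ ht hB⟩

/-- The dominant type of `x`. -/
def dominantType (x : TorusB n) : DominantType := x.existsUnique_hasDominantType.choose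

theorem dominantType_eq_iff (x : TorusB n) (t : DominantType) :
    x.dominantType = t ↔ x.HasDominantType t :=
  ⟨fun h => h ▸ x.existsUnique_hasDominantType.choose_spec.1,
    fun h => (x.existsUnique_hasDominantType.choose_spec.2 t h).symm⟩

/-- `S_x` for `x` of dominant type `B`, `D` or `S`, and `S_x^{(p)}` for `x` of dominant type `BD`,
where `S_x^{(1)} = 2u+1` and `S_x^{(2)} = 2v`. -/
def bigS (p : ℕ) (x : TorusB n) : ℕ :=
  match x.dominantType with
  | .B => 2 * x.u + 1
  | .D => 2 * x.v
  | .S => x.s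
  | .BD => if p = 1 then 2 * x.u + 1 else 2 * x.v

open Classical in
/-- The parity of a tuple: `1` if an odd number of the `x_j` are of dominant type `D`, else `2`. -/
def parity {L : ℕ} (x : Fin L → TorusB n) : ℕ :=
  if Odd (Nat.card {j // (x j).dominantType = .D}) then 1 else 2

/-- Eligibility of a tuple; the four disjuncts are exclusive. The inequalities are read in `ℤ`. -/
def Eligible {L : ℕ} (x : Fin L → TorusB n) : Prop :=
  -- at least two of the `x_j` are of dominant type `BD` or `S`
  (∃ i j, i ≠ j ∧ ((x i).dominantType = .BD ∨ (x i).dominantType = .S) ∧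
    ((x j).dominantType = .BD ∨ (x j).dominantType = .S)) ∨
  -- exactly one is of dominant type `S`, none of dominant type `BD`
  ((∃! j, (x j).dominantType = .S) ∧ (∀ j, (x j).dominantType ≠ .BD) ∧
    (∑ j, ((x j).bigS (parity x) : ℤ)) ≤ (2 * n + 1) * ((L : ℤ) - 1)) ∨
  -- exactly one is of dominant type `BD`, none of dominant type `S`
  ((∃! j, (x j).dominantType = .BD) ∧ (∀ j, (x j).dominantType ≠ .S) ∧
    (∑ j, ((x j).bigS (parity x) : ℤ)) ≤ (2 * n + 1) * ((L : ℤ) - 1)) ∨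
  -- none is of dominant type `BD` or `S`
  ((∀ j, (x j).dominantType ≠ .BD ∧ (x j).dominantType ≠ .S) ∧
    (∑ j, ((x j).bigS (parity x) : ℤ)) ≤ (2 * n + 1) * ((L : ℤ) - 1) + parity x - 1)

end TorusB

end

noncomputable section

/-!
Fix complex numbers `α i`. Codimensions of eigenspaces are subadditive: if
`y = ∏ g i * x i * (g i)⁻¹`, then the codimension of the `∏ α i`-eigenspace of `y` is at most the
sum of the codimensions of the `α i`-eigenspaces of the `x i`. For Haar almost every `y` the former
is at least `2n+1`, or `2n` if `∏ α i = 1`, so an absolutely continuous tuple satisfies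
`∑ dim ker (x i - α i) ≤ (2n+1)(L-1) + [∏ α i = 1]`. Taking for `α i` an eigenvalue whose
multiplicity is at least `S_{x i}` gives the proposition: without elements of type `BD` or `S` one
has `∏ α i = (-1) ^ p`, and a single element of type `BD` or `S` leaves enough freedom to reach
`∏ α i ≠ 1`.

That generic eigenspaces are as small as possible is an instance of the fact that a real analytic
function on `SO(m)` either vanishes identically or is almost everywhere nonzero. Indeed, let `Z` be
its zero set. The products of two reflections are joined to `1` by analytic curves, along which a
translate of `Z` cannot change without missing almost every point; hence `Z` is almost invariant
under these products. They generate `SO(m)`, so `Z` is null or conull by ergodicity.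
-/

/-! ### Reflections generate the special orthogonal group -/

section Reflections

variable {m : Type*} [Fintype m] [DecidableEq m]

/-- An orthogonal matrix regarded as a linear isometry of Euclidean space. -/
def orthogonalGroupEquiv :
    Matrix.orthogonalGroup m ℝ ≃* (EuclideanSpace ℝ m ≃ₗᵢ[ℝ] EuclideanSpace ℝ m) :=
  let clm := Unitary.mapEquiv (StarMulEquiv.ofClass (Matrix.toEuclideanCLM (n := m) (𝕜 := ℝ)))
  clm.toMulEquiv.trans Unitary.linearIsometryEquiv

theorem orthogonalGroupEquiv_toLinearMap (h : Matrix.orthogonalGroup m ℝ) :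
    (orthogonalGroupEquiv h).toLinearEquiv.toLinearMap = Matrix.toEuclideanLin h.1 :=
  rfl

/-- The matrix of the orthogonal reflection in the hyperplane `vᗮ` (the identity if `v = 0`). -/
def reflectionMatrix (v : EuclideanSpace ℝ m) : Matrix.orthogonalGroup m ℝ :=
  orthogonalGroupEquiv.symm (ℝ ∙ v)ᗮ.reflection

theorem toEuclideanLin_reflectionMatrix (v : EuclideanSpace ℝ m) :
    Matrix.toEuclideanLin (reflectionMatrix v).1 = (ℝ ∙ v)ᗮ.reflection.toLinearMap := by
  rw [← orthogonalGroupEquiv_toLinearMap, reflectionMatrix, MulEquiv.apply_symm_apply]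

theorem reflectionMatrix_apply (v : EuclideanSpace ℝ m) (i j : m) :
    (reflectionMatrix v).1 i j = (1 : Matrix m m ℝ) i j - 2 * (v i * v j) / ‖v‖ ^ 2 := calc
  (reflectionMatrix v).1 i j
    = Matrix.toEuclideanLin (reflectionMatrix v).1 (EuclideanSpace.single j 1) i := by simp
  _ = (ℝ ∙ v)ᗮ.reflection (EuclideanSpace.single j 1) i := by
    rw [toEuclideanLin_reflectionMatrix]
    rfl
  _ = (1 : Matrix m m ℝ) i j - 2 * (v j / ‖v‖ ^ 2 * v i) := by
    simp [Submodule.reflection_orthogonal_apply, Submodule.reflection_singleton_apply,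
      EuclideanSpace.inner_single_right, Matrix.one_apply]
  _ = (1 : Matrix m m ℝ) i j - 2 * (v i * v j) / ‖v‖ ^ 2 := by ring

theorem reflectionMatrix_smul {c : ℝ} (hc : c ≠ 0) (v : EuclideanSpace ℝ m) :
    reflectionMatrix (c • v) = reflectionMatrix v := by
  simp only [reflectionMatrix, Submodule.span_singleton_smul_eq hc.isUnit]

theorem reflectionMatrix_zero : reflectionMatrix (0 : EuclideanSpace ℝ m) = 1 := by
  ext i j
  simp [reflectionMatrix_apply]

theorem reflectionMatrix_mul_self (v : EuclideanSpace ℝ m) :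
    reflectionMatrix v * reflectionMatrix v = 1 := by
  rw [reflectionMatrix, ← map_mul, Submodule.reflection_mul_reflection, map_one]

theorem det_reflectionMatrix {v : EuclideanSpace ℝ m} (hv : v ≠ 0) :
    (reflectionMatrix v).1.det = -1 := by
  have hrank : Module.finrank ℝ (ℝ ∙ v)ᗮᗮ = 1 := by
    rw [Submodule.orthogonal_orthogonal, finrank_span_singleton hv]
  rw [← LinearMap.det_toLpLin 2, toEuclideanLin_reflectionMatrix, Submodule.det_reflection, hrank,
    pow_one]

theorem exists_eq_prod_reflectionMatrix (h : Matrix.orthogonalGroup m ℝ) :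
    ∃ l : List (EuclideanSpace ℝ m), h = (l.map reflectionMatrix).prod := by
  obtain ⟨l, -, hl⟩ := (orthogonalGroupEquiv h).reflections_generate_dim
  refine ⟨l, orthogonalGroupEquiv.injective ?_⟩
  rw [hl, map_list_prod, List.map_map]
  congr
  funext v
  simp [reflectionMatrix]

/-- The product of two reflections, as an element of the special orthogonal group. -/
def reflectionPair {a b : EuclideanSpace ℝ m} (ha : a ≠ 0) (hb : b ≠ 0) :
    Matrix.specialOrthogonalGroup m ℝ :=
  ⟨(reflectionMatrix a * reflectionMatrix b).1,
    Matrix.mem_specialOrthogonalGroup_iff.2 ⟨Subtype.property _, by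
      simp [det_reflectionMatrix ha, det_reflectionMatrix hb]⟩⟩

theorem coe_reflectionPair {a b : EuclideanSpace ℝ m} (ha : a ≠ 0) (hb : b ≠ 0) :
    (reflectionPair ha hb).1 = (reflectionMatrix a).1 * (reflectionMatrix b).1 :=
  rfl

theorem reflectionPair_eq_one {a b : EuclideanSpace ℝ m} (ha : a ≠ 0) (hb : b ≠ 0)
    (hab : ∃ r : ℝ, r • b = a) : reflectionPair ha hb = 1 := by
  obtain ⟨r, rfl⟩ := hab
  refine Subtype.ext ?_
  rw [coe_reflectionPair, reflectionMatrix_smul (left_ne_zero_of_smul ha)]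
  exact congrArg Subtype.val (reflectionMatrix_mul_self b)

-- The second component takes care of the products with an odd number of factors, which only lie in
-- the special orthogonal group after one more reflection.
theorem mem_of_eq_prod_reflectionMatrix {S : Subgroup (Matrix.specialOrthogonalGroup m ℝ)}
    (hS : ∀ (a b : EuclideanSpace ℝ m) (ha : a ≠ 0) (hb : b ≠ 0), reflectionPair ha hb ∈ S)
    (l : List (EuclideanSpace ℝ m)) :
    (∀ g : Matrix.specialOrthogonalGroup m ℝ, g.1 = (l.map reflectionMatrix).prod.1 → g ∈ S) ∧
      ∀ b ≠ 0, ∀ g : Matrix.specialOrthogonalGroup m ℝ,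
        g.1 = (reflectionMatrix b).1 * (l.map reflectionMatrix).prod.1 → g ∈ S := by
  induction l with
  | nil =>
    refine ⟨fun g hg => ?_, fun b hb g hg => ?_⟩
    · rw [show g = 1 from Subtype.ext hg]
      exact S.one_mem
    · have hdet : g.1.det = 1 := g.2.2
      rw [hg, List.map_nil, List.prod_nil, OneMemClass.coe_one, mul_one,
        det_reflectionMatrix hb] at hdet
      norm_num at hdet
  | cons a l ih =>
    by_cases ha : a = 0
    · simpa only [ha, List.map_cons, List.prod_cons, reflectionMatrix_zero, one_mul] using ih
    refine ⟨fun g hg => ih.2 a ha g hg, fun b hb g hg => ?_⟩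
    have hg' : (reflectionPair ha hb * g).1 = (l.map reflectionMatrix).prod.1 := calc
      _ = (reflectionMatrix a * reflectionMatrix b *
            (reflectionMatrix b * (reflectionMatrix a * (l.map reflectionMatrix).prod))).1 :=
        congrArg ((reflectionMatrix a * reflectionMatrix b).1 * ·) hg
      _ = (l.map reflectionMatrix).prod.1 := by
        rw [mul_assoc, ← mul_assoc (reflectionMatrix b), reflectionMatrix_mul_self, one_mul,
          ← mul_assoc, reflectionMatrix_mul_self, one_mul]
    exact (S.mul_mem_cancel_left (hS a b ha hb)).1 (ih.1 _ hg')

theorem subgroup_eq_top_of_reflectionPair_mem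
    {S : Subgroup (Matrix.specialOrthogonalGroup m ℝ)}
    (hS : ∀ (a b : EuclideanSpace ℝ m) (ha : a ≠ 0) (hb : b ≠ 0), reflectionPair ha hb ∈ S) :
    S = ⊤ := by
  refine (Subgroup.eq_top_iff' S).2 fun g => ?_
  obtain ⟨l, hl⟩ := exists_eq_prod_reflectionMatrix ⟨g.1, g.2.1⟩
  exact (mem_of_eq_prod_reflectionMatrix hS l).1 g (congrArg Subtype.val hl)

end Reflections

/-! ### Zeros of analytic functions on the special orthogonal group -/

theorem mem_aestabilizer_of_forall_or_ae_notMem {G T : Type*} [Group G] [MeasurableSpace G]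
    [MeasurableMul₂ G] {μ : Measure G} [IsFiniteMeasure μ] [μ.IsMulLeftInvariant]
    [MeasurableSpace T] {ν : Measure T} [SFinite ν] [NeZero ν] {c : T → G} (hc : Measurable c)
    {t₀ : T} (ht₀ : c t₀ = 1) {Z : Set G} (hZ : MeasurableSet Z)
    (h : ∀ g, (∀ t, c t * g ∈ Z) ∨ ∀ᵐ t ∂ν, c t * g ∉ Z) (s : T) :
    c s ∈ MulAction.aestabilizer G μ Z := by
  have hmeas (r : T) : MeasurableSet ((c r * ·) ⁻¹' Z) := measurable_const_mul (c r) hZ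
  have hsubset : ∀ᵐ t ∂ν, ∀ᵐ g ∂μ, c t * g ∈ Z → c s * g ∈ Z ∧ c t₀ * g ∈ Z := by
    refine (Measure.ae_ae_comm ?_).2 (.of_forall fun g => ?_)
    · have hprod : Measurable fun p : T × G => c p.1 * p.2 :=
        (hc.comp measurable_fst).mul measurable_snd
      exact (hprod hZ).imp ((measurable_snd (hmeas s)).inter (measurable_snd (hmeas t₀)))
    · rcases h g with hg | hg
      · exact .of_forall fun t _ => ⟨hg s, hg t₀⟩
      · filter_upwards [hg] with t ht htZ using absurd htZ ht
  obtain ⟨t, ht⟩ := hsubset.exists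
  -- All translates of `Z` have the same finite measure, so an almost inclusion between two of them
  -- is an almost equality.
  have heq (r : T) (hr : ∀ᵐ g ∂μ, c t * g ∈ Z → c r * g ∈ Z) :
      (c t * ·) ⁻¹' Z =ᵐ[μ] (c r * ·) ⁻¹' Z :=
    ae_eq_of_ae_subset_of_measure_ge hr (by simp only [measure_preimage_mul, le_refl])
      (hmeas t).nullMeasurableSet (measure_ne_top μ _)
  have hs : (c s * ·) ⁻¹' Z =ᵐ[μ] Z := by
    simpa [ht₀] using (heq s (ht.mono fun g hg hgt => (hg hgt).1)).symm.trans
      (heq t₀ (ht.mono fun g hg hgt => (hg hgt).2))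
  rw [← inv_mem_iff, MulAction.mem_aestabilizer, ← Set.preimage_smul]
  exact hs

theorem measure_eq_zero_of_aestabilizer_eq_top {G : Type*} [Group G] [TopologicalSpace G]
    [MeasurableSpace G] [BorelSpace G] [MeasurableMul₂ G] [MeasurableInv G] {μ : Measure G}
    [SFinite μ] [μ.IsMulLeftInvariant] [μ.IsOpenPosMeasure] {Z : Set G} (hZ : IsClosed Z)
    (hne : Z ≠ Set.univ) (h : MulAction.aestabilizer G μ Z = ⊤) : μ Z = 0 := by
  have hconst := MulAction.aeconst_of_aestabilizer_eq_top (G := G)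
    hZ.measurableSet.nullMeasurableSet h
  rcases Filter.eventuallyConst_set.1 hconst with hfull | hnull
  · exact absurd (hZ.ae_eq_univ_iff_eq.1 (Filter.eventuallyEq_univ.2 hfull)) hne
  · exact measure_eq_zero_iff_ae_notMem.2 hnull

theorem ae_ne_zero_of_analyticOnNhd {E : Type*} [NormedAddCommGroup E] [NormedSpace ℝ E]
    {f : ℝ → E} (hf : AnalyticOnNhd ℝ f Set.univ) {t : ℝ} (ht : f t ≠ 0) : ∀ᵐ s, f s ≠ 0 := by
  have h := ae_restrict_le_codiscreteWithin (μ := (volume : Measure ℝ)) MeasurableSet.univ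
    (hf.preimage_zero_mem_codiscrete ht)
  rw [Measure.restrict_univ] at h
  filter_upwards [h] with s hs using by simpa using hs

section AnalyticZeros

variable {m : Type*} [Fintype m] [DecidableEq m]

instance : SecondCountableTopology (Matrix.specialOrthogonalGroup m ℝ) :=
  have : SecondCountableTopology (Matrix m m ℝ) :=
    inferInstanceAs (SecondCountableTopology (m → m → ℝ))
  TopologicalSpace.Subtype.secondCountableTopology _

instance : IsTopologicalGroup (Matrix.specialOrthogonalGroup m ℝ) where
  continuous_inv := continuous_subtype_val.matrix_transpose.subtype_mk _

theorem analyticOnNhd_reflectionMatrix_lineMap {a b : EuclideanSpace ℝ m}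
    (hab : ∀ t : ℝ, AffineMap.lineMap b a t ≠ 0) (i j : m) :
    AnalyticOnNhd ℝ (fun t : ℝ => (reflectionMatrix (AffineMap.lineMap b a t)).1 i j)
      Set.univ := by
  intro t _
  let v (t : ℝ) : EuclideanSpace ℝ m := AffineMap.lineMap b a t
  have hcoord (k : m) : AnalyticAt ℝ (fun t => v t k) t := by
    simp only [v, AffineMap.lineMap_apply_module, PiLp.add_apply, PiLp.smul_apply, smul_eq_mul]
    fun_prop
  have hnorm : AnalyticAt ℝ (fun t => ‖v t‖ ^ 2) t := by
    simp only [EuclideanSpace.real_norm_sq_eq]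
    exact Finset.analyticAt_fun_sum _ fun k _ => (hcoord k).pow 2
  simp only [reflectionMatrix_apply]
  exact analyticAt_const.sub ((analyticAt_const.mul ((hcoord i).mul (hcoord j))).div hnorm
    (pow_ne_zero 2 (norm_ne_zero_iff.2 (hab t))))

theorem analyticOnNhd_reflectionPair_lineMap_mul {a b : EuclideanSpace ℝ m}
    (hab : ∀ t : ℝ, AffineMap.lineMap b a t ≠ 0) (hb : b ≠ 0)
    (g : Matrix.specialOrthogonalGroup m ℝ) :
    AnalyticOnNhd ℝ (fun t : ℝ => show m → m → ℝ from (reflectionPair (hab t) hb * g).1)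
      Set.univ := by
  refine AnalyticOnNhd.pi fun i => AnalyticOnNhd.pi fun j => ?_
  have hentry (t : ℝ) : (reflectionPair (hab t) hb * g).1 i j =
      ∑ k, (∑ l, (reflectionMatrix (AffineMap.lineMap b a t)).1 i l *
        (reflectionMatrix b).1 l k) * g.1 k j :=
    rfl
  simp only [hentry]
  exact Finset.analyticOnNhd_fun_sum _ fun k _ => (Finset.analyticOnNhd_fun_sum _ fun l _ =>
    (analyticOnNhd_reflectionMatrix_lineMap hab i l).mul analyticOnNhd_const).mul
      analyticOnNhd_const

theorem exists_smul_eq_of_lineMap_eq_zero {V : Type*} [AddCommGroup V] [Module ℝ V] {a b : V}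
    (hb : b ≠ 0) {t : ℝ} (h : AffineMap.lineMap b a t = 0) : ∃ r : ℝ, r • b = a := by
  have ht : t ≠ 0 := by
    rintro rfl
    exact hb (by rwa [AffineMap.lineMap_apply_zero] at h)
  rw [AffineMap.lineMap_apply_module] at h
  refine ⟨t⁻¹ * (t - 1), ?_⟩
  rw [mul_smul, inv_smul_eq_iff₀ ht, ← neg_sub, neg_smul, eq_neg_of_add_eq_zero_left h, neg_neg]

variable {E : Type*} [NormedAddCommGroup E] [NormedSpace ℝ E] {f : (m → m → ℝ) → E}

theorem isClosed_setOf_apply_eq_zero (hf : AnalyticOnNhd ℝ f Set.univ) :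
    IsClosed {g : Matrix.specialOrthogonalGroup m ℝ | f g.1 = 0} :=
  isClosed_eq (hf.continuousOn.comp_continuous continuous_subtype_val fun _ => trivial)
    continuous_const

variable [MeasurableSpace (Matrix.specialOrthogonalGroup m ℝ)]
  [BorelSpace (Matrix.specialOrthogonalGroup m ℝ)]
  (μ : Measure (Matrix.specialOrthogonalGroup m ℝ)) [IsFiniteMeasure μ] [μ.IsMulLeftInvariant]

theorem reflectionPair_mem_aestabilizer (hf : AnalyticOnNhd ℝ f Set.univ)
    {a b : EuclideanSpace ℝ m} (ha : a ≠ 0) (hb : b ≠ 0) :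
    reflectionPair ha hb ∈ MulAction.aestabilizer (Matrix.specialOrthogonalGroup m ℝ) μ
      {g : Matrix.specialOrthogonalGroup m ℝ | f g.1 = 0} := by
  by_cases hab : ∀ t : ℝ, AffineMap.lineMap b a t ≠ 0
  swap
  · obtain ⟨t, ht⟩ := not_forall_not.1 hab
    rw [reflectionPair_eq_one ha hb (exists_smul_eq_of_lineMap_eq_zero hb ht)]
    exact one_mem _
  let c (t : ℝ) : Matrix.specialOrthogonalGroup m ℝ := reflectionPair (hab t) hb
  have hanalytic := analyticOnNhd_reflectionPair_lineMap_mul hab hb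
  have hc : Continuous c := by
    have hc_one := continuousOn_univ.1 (hanalytic 1).continuousOn
    simp only [mul_one] at hc_one
    exact hc_one.subtype_mk _
  have hc_zero : c 0 = 1 := reflectionPair_eq_one _ hb ⟨1, by simp⟩
  have hc_one : c 1 = reflectionPair ha hb := by simp [c]
  rw [← hc_one]
  refine mem_aestabilizer_of_forall_or_ae_notMem (ν := (volume : Measure ℝ)) hc.measurable hc_zero
    (isClosed_setOf_apply_eq_zero hf).measurableSet (fun g => or_iff_not_imp_left.2 fun hg => ?_) 1
  obtain ⟨t, ht⟩ := not_forall.1 hg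
  exact ae_ne_zero_of_analyticOnNhd (hf.comp (hanalytic g) fun _ _ => trivial) ht

variable [μ.IsOpenPosMeasure]

theorem ae_ne_zero_specialOrthogonalGroup (hf : AnalyticOnNhd ℝ f Set.univ)
    {g₀ : Matrix.specialOrthogonalGroup m ℝ} (hg₀ : f g₀.1 ≠ 0) : ∀ᵐ g ∂μ, f g.1 ≠ 0 := by
  refine measure_eq_zero_iff_ae_notMem.1 (measure_eq_zero_of_aestabilizer_eq_top
    (isClosed_setOf_apply_eq_zero hf) (fun h => hg₀ (h.ge trivial)) ?_)
  exact subgroup_eq_top_of_reflectionPair_mem fun a b => reflectionPair_mem_aestabilizer μ hf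

end AnalyticZeros

/-! ### Ranks and eigenspaces -/

theorem rank_add_le_rank_add_rank {m k K : Type*} [Fintype k] [Field K]
    (A B : Matrix m k K) : (A + B).rank ≤ A.rank + B.rank := by
  rw [Matrix.rank, Matrix.mulVecLin_add]
  exact (Submodule.finrank_mono (LinearMap.range_add_le _ _)).trans
    (Submodule.finrank_add_le_finrank_add_finrank _ _)

section EigenCodim

variable {m K : Type*} [Fintype m] [DecidableEq m] [Field K]

/-- The codimension of the `α`-eigenspace of `A`. -/
def eigenCodim (A : Matrix m m K) (α : K) : ℕ := (A - Matrix.scalar m α).rank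

theorem eigenCodim_one_one : eigenCodim (1 : Matrix m m K) 1 = 0 := by
  rw [eigenCodim, map_one, sub_self, Matrix.rank_zero]

theorem eigenCodim_mul_le (A B : Matrix m m K) (α β : K) :
    eigenCodim (A * B) (α * β) ≤ eigenCodim A α + eigenCodim B β := by
  have hcomm : A * Matrix.scalar m β = Matrix.scalar m β * A :=
    (Matrix.scalar_commute β (Commute.all β) A).eq.symm
  have hsplit : A * B - Matrix.scalar m (α * β) =
      Matrix.scalar m β * (A - Matrix.scalar m α) + A * (B - Matrix.scalar m β) := by
    rw [mul_comm α β, map_mul, mul_sub, mul_sub, hcomm]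
    abel
  rw [eigenCodim, hsplit]
  exact (rank_add_le_rank_add_rank _ _).trans
    (add_le_add (Matrix.rank_mul_le_right _ _) (Matrix.rank_mul_le_right _ _))

theorem eigenCodim_prod_ofFn_le {L : ℕ} (A : Fin L → Matrix m m K) (α : Fin L → K) :
    eigenCodim (List.ofFn A).prod (∏ i, α i) ≤ ∑ i, eigenCodim (A i) (α i) := by
  induction L with
  | zero => simp [eigenCodim_one_one]
  | succ L ih =>
    rw [List.ofFn_succ, List.prod_cons, Fin.prod_univ_succ, Fin.sum_univ_succ]
    exact (eigenCodim_mul_le _ _ _ _).trans (Nat.add_le_add_left (ih _ _) _)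

theorem eigenCodim_eq_of_mul_eq_mul {A B P : Matrix m m K} (hP : IsUnit P) (h : A * P = P * B)
    (α : K) : eigenCodim A α = eigenCodim B α := by
  have hdet := (Matrix.isUnit_iff_isUnit_det P).1 hP
  have hsub : (A - Matrix.scalar m α) * P = P * (B - Matrix.scalar m α) := by
    rw [sub_mul, mul_sub, h, (Matrix.scalar_commute α (Commute.all α) P).eq]
  rw [eigenCodim, eigenCodim, ← Matrix.rank_mul_eq_left_of_isUnit_det P _ hdet, hsub,
    Matrix.rank_mul_eq_right_of_isUnit_det P _ hdet]

theorem card_add_eigenCodim_diagonal (d : m → K) (α : K) :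
    Nat.card {i // d i = α} + eigenCodim (Matrix.diagonal d) α = Fintype.card m := by
  classical
  rw [eigenCodim, Matrix.scalar_apply, Matrix.diagonal_sub, Matrix.rank_diagonal]
  simp only [sub_ne_zero, Nat.card_eq_fintype_card]
  rw [Fintype.card_subtype_compl]
  exact Nat.add_sub_cancel' (Fintype.card_subtype_le _)

end EigenCodim

section GenericRank

variable {m k V : Type*} [Fintype k] [NormedAddCommGroup V] [NormedSpace ℝ V]

theorem analyticOnNhd_det [DecidableEq k] {F : V → Matrix k k ℂ}
    (hF : ∀ i j, AnalyticOnNhd ℝ (fun A => F A i j) Set.univ) :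
    AnalyticOnNhd ℝ (fun A => (F A).det) Set.univ := by
  simp only [Matrix.det_apply']
  exact Finset.analyticOnNhd_fun_sum _ fun σ _ => analyticOnNhd_const.mul
    (Finset.analyticOnNhd_fun_prod _ fun i _ => hF _ _)

theorem analyticOnNhd_mul_mul_apply {F : V → Matrix k k ℂ}
    (hF : ∀ i j, AnalyticOnNhd ℝ (fun A => F A i j) Set.univ) (P Q : Matrix k k ℂ) (i j : k) :
    AnalyticOnNhd ℝ (fun A => (P * F A * Q) i j) Set.univ := by
  simp only [Matrix.mul_apply]
  exact Finset.analyticOnNhd_fun_sum _ fun _ _ => (Finset.analyticOnNhd_fun_sum _ fun _ _ =>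
    analyticOnNhd_const.mul (hF _ _)).mul analyticOnNhd_const

variable [Fintype m] [DecidableEq m]

/-- The inclusion of the special orthogonal group in the complex matrices, so that non-real
eigenvalues can be considered. -/
def complexMatrix : Matrix.specialOrthogonalGroup m ℝ →* Matrix m m ℂ :=
  Complex.ofRealHom.mapMatrix.toMonoidHom.comp
    (Matrix.specialOrthogonalGroup m ℝ).subtype

variable [MeasurableSpace (Matrix.specialOrthogonalGroup m ℝ)]
  [BorelSpace (Matrix.specialOrthogonalGroup m ℝ)]
  (μ : Measure (Matrix.specialOrthogonalGroup m ℝ)) [IsFiniteMeasure μ] [μ.IsMulLeftInvariant]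
  [μ.IsOpenPosMeasure]

theorem ae_rank_le_rank {F : (m → m → ℝ) → Matrix k k ℂ}
    (hF : ∀ i j, AnalyticOnNhd ℝ (fun A => F A i j) Set.univ)
    (g₀ : Matrix.specialOrthogonalGroup m ℝ) :
    ∀ᵐ g ∂μ, (F g₀.1).rank ≤ (F g.1).rank := by
  classical
  obtain ⟨P, Q, e, -, -, hnormal⟩ := (F g₀.1).exists_rank_normal_form
  let minor (A : m → m → ℝ) : Matrix (Fin (F g₀.1).rank) (Fin (F g₀.1).rank) ℂ :=
    (P * F A * Q).submatrix (e.symm ∘ Sum.inl) (e.symm ∘ Sum.inl)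
  have hminor : minor g₀.1 = 1 := by
    ext i j
    simp [minor, hnormal, Matrix.fromBlocks, Matrix.one_apply]
  have hanalytic : AnalyticOnNhd ℝ (fun A => (minor A).det) Set.univ :=
    analyticOnNhd_det fun i j => analyticOnNhd_mul_mul_apply hF P Q _ _
  have hdet : (minor g₀.1).det ≠ 0 := by
    rw [hminor, Matrix.det_one]
    exact one_ne_zero
  filter_upwards [ae_ne_zero_specialOrthogonalGroup μ hanalytic hdet] with g hg
  calc (F g₀.1).rank
    _ = (minor g.1).rank := by rw [Matrix.rank_of_det_ne_zero hg, Fintype.card_fin]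
    _ ≤ (P * F g.1 * Q).rank := Matrix.rank_submatrix_le _ _ _
    _ ≤ (P * F g.1).rank := Matrix.rank_mul_le_left _ _
    _ ≤ (F g.1).rank := Matrix.rank_mul_le_right _ _

theorem ae_eigenCodim_le_eigenCodim (g₀ : Matrix.specialOrthogonalGroup m ℝ) (α : ℂ) :
    ∀ᵐ g ∂μ, eigenCodim (complexMatrix g₀) α ≤ eigenCodim (complexMatrix g) α := by
  let F (A : m → m → ℝ) : Matrix m m ℂ :=
    Matrix.of (fun i j => (A i j : ℂ)) - Matrix.scalar m α
  have hF (i j : m) : AnalyticOnNhd ℝ (fun A => F A i j) Set.univ := by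
    let entry : (m → m → ℝ) →L[ℝ] ℂ :=
      (Complex.ofRealCLM.comp (ContinuousLinearMap.proj j)).comp (ContinuousLinearMap.proj i)
    exact (entry.analyticOnNhd _).sub analyticOnNhd_const
  exact ae_rank_le_rank μ hF g₀

end GenericRank

/-! ### Eigenvalues of torus elements -/

namespace TorusB

variable {n : ℕ}

/-- The eigenvalues of `x.toSO`: `x j` and `(x j)⁻¹` for each block, and a final `1`. -/
def weight (x : TorusB n) : CoordIdx n → Circle :=
  Sum.elim (fun p => ![x p.2, (x p.2)⁻¹] p.1) 1

/-- A basis of common eigenvectors of the torus: the columns `(1, -i)` and `(1, i)` of a block are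
eigenvectors of every plane rotation. -/
def eigenbasis (n : ℕ) : Matrix (CoordIdx n) (CoordIdx n) ℂ :=
  Matrix.fromBlocks (Matrix.blockDiagonal fun _ => !![1, 1; -Complex.I, Complex.I]) 0 0 1

theorem isUnit_eigenbasis : IsUnit (eigenbasis n) := by
  rw [Matrix.isUnit_iff_isUnit_det, eigenbasis, Matrix.det_fromBlocks_zero₂₁,
    Matrix.det_blockDiagonal, Matrix.det_one, mul_one, isUnit_iff_ne_zero]
  refine Finset.prod_ne_zero_iff.2 fun _ _ => ?_
  rw [Matrix.det_fin_two_of]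
  simp [← two_mul]

theorem rotBlock_mul (z : Circle) :
    (rotBlock z).map (↑) * (!![1, 1; -Complex.I, Complex.I] : Matrix (Fin 2) (Fin 2) ℂ) =
      !![1, 1; -Complex.I, Complex.I] * Matrix.diagonal ![(z : ℂ), (z⁻¹ : Circle)] := by
  rw [Circle.coe_inv_eq_conj]
  ext i j
  fin_cases i <;> fin_cases j <;>
    simp [rotBlock, Matrix.mul_apply, Fin.sum_univ_two, Complex.ext_iff]

theorem complexMatrix_toSO_mul_eigenbasis (x : TorusB n) :
    complexMatrix x.toSO * eigenbasis n =
      eigenbasis n * Matrix.diagonal fun i => (x.weight i : ℂ) := by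
  have hleft : complexMatrix x.toSO = Matrix.fromBlocks
      (Matrix.blockDiagonal fun j => (rotBlock (x j)).map (↑)) 0 0 1 := by
    change x.toMatrix.map Complex.ofReal = _
    rw [toMatrix, Matrix.fromBlocks_map, Matrix.blockDiagonal_map _ _ Complex.ofReal_zero,
      Matrix.map_zero _ Complex.ofReal_zero, Matrix.map_zero _ Complex.ofReal_zero,
      Matrix.map_one _ Complex.ofReal_zero Complex.ofReal_one]
  have hright : (Matrix.diagonal fun i => (x.weight i : ℂ)) = Matrix.fromBlocks
      (Matrix.blockDiagonal fun j => Matrix.diagonal ![(x j : ℂ), ((x j)⁻¹ : Circle)]) 0 0 1 := by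
    rw [Matrix.blockDiagonal_diagonal, ← Matrix.diagonal_one, Matrix.fromBlocks_diagonal]
    congr
    funext i
    rcases i with ⟨k, j⟩ | _
    · fin_cases k <;> rfl
    · rfl
  rw [hleft, hright, eigenbasis, Matrix.fromBlocks_multiply, Matrix.fromBlocks_multiply]
  simp only [Matrix.mul_zero, Matrix.zero_mul, add_zero, zero_add, mul_one,
    ← Matrix.blockDiagonal_mul, rotBlock_mul]

theorem card_weight_add_eigenCodim (x : TorusB n) (α : ℂ) :
    Nat.card {i // (x.weight i : ℂ) = α} + eigenCodim (complexMatrix x.toSO) α = 2 * n + 1 := by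
  rw [eigenCodim_eq_of_mul_eq_mul isUnit_eigenbasis x.complexMatrix_toSO_mul_eigenbasis,
    card_add_eigenCodim_diagonal, card_coordIdx]

theorem card_add_card_inv_add_eigenCodim (x : TorusB n) (α : ℂ) :
    Nat.card {j // (x j : ℂ) = α} + Nat.card {j // (x j : ℂ)⁻¹ = α} + (if α = 1 then 1 else 0) +
      eigenCodim (complexMatrix x.toSO) α = 2 * n + 1 := by
  rw [← x.card_weight_add_eigenCodim α]
  simp only [Nat.card_eq_fintype_card, Fintype.card_subtype, Finset.card_filter,
    Fintype.sum_sum_type, Fintype.sum_prod_type, Fin.sum_univ_two]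
  simp [weight, -Finset.sum_boole, eq_comm]

theorem two_mul_u_add_one_add_eigenCodim (x : TorusB n) :
    2 * x.u + 1 + eigenCodim (complexMatrix x.toSO) 1 = 2 * n + 1 := by
  rw [← x.card_add_card_inv_add_eigenCodim 1]
  simp only [u, inv_eq_one, Circle.coe_eq_one, if_true, two_mul]

theorem two_mul_v_add_eigenCodim (x : TorusB n) :
    2 * x.v + eigenCodim (complexMatrix x.toSO) (-1) = 2 * n + 1 := by
  rw [← x.card_add_card_inv_add_eigenCodim (-1)]
  simp [v, two_mul, inv_eq_iff_eq_inv, show (-1 : ℂ) ≠ 1 by norm_num]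

theorem mult_add_eigenCodim_le (x : TorusB n) (z : Circle) :
    x.mult z + eigenCodim (complexMatrix x.toSO) z ≤ 2 * n + 1 := by
  classical
  have hmult : x.mult z ≤ Nat.card {j // (x j : ℂ) = z} + Nat.card {j // (x j : ℂ)⁻¹ = z} := by
    simp only [mult, Nat.card_eq_fintype_card, ← Circle.coe_inv, Circle.coe_inj, inv_eq_iff_eq_inv]
    exact Fintype.card_subtype_or _ _
  have := x.card_add_card_inv_add_eigenCodim z
  omega

theorem exists_s_eq_mult {x : TorusB n} (hs : 0 < x.s) :
    ∃ z : Circle, x.s = x.mult z ∧ (z : ℂ) ≠ 1 ∧ (z : ℂ) ≠ -1 := by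
  classical
  rw [s] at hs ⊢
  obtain ⟨j₀, hj₀, -⟩ := Finset.lt_sup_iff.1 hs
  obtain ⟨j, hj, hjs⟩ := Finset.exists_mem_eq_sup _ ⟨j₀, hj₀⟩ fun j => x.mult (x j)
  obtain ⟨-, hj1, hj2⟩ := Finset.mem_filter.1 hj
  exact ⟨x j, hjs, fun h => hj1 (Circle.ext h), hj2⟩

end TorusB

/-! ### Absolute continuity -/

namespace SOdd

variable {n : ℕ}

instance : (haar n).IsMulLeftInvariant := by
  unfold haar
  infer_instance

instance : (haar n).IsOpenPosMeasure := by
  unfold haar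
  infer_instance

theorem ae_le_eigenCodim (α : ℂ) :
    ∀ᵐ g ∂haar n, 2 * n + 1 ≤ eigenCodim (complexMatrix g) α + if α = 1 then 1 else 0 := by
  obtain ⟨ζ, hζ, hζ'⟩ : ∃ ζ : Circle, (ζ : ℂ) ≠ α ∧ (ζ : ℂ)⁻¹ ≠ α := by
    by_cases hα : α = 1
    · refine ⟨Circle.exp Real.pi, ?_⟩
      norm_num [hα, Complex.exp_pi_mul_I]
    · exact ⟨1, by simpa using Ne.symm hα⟩
  have hcodim := TorusB.card_add_card_inv_add_eigenCodim (fun _ : Fin n => ζ) α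
  simp only [hζ, hζ', Nat.card_of_isEmpty, zero_add] at hcodim
  filter_upwards [ae_eigenCodim_le_eigenCodim (haar n) (TorusB.toSO fun _ => ζ) α] with g hg
  omega

end SOdd

namespace TorusB

variable {n : ℕ}

theorem convOrbital_succ {L : ℕ} (x : Fin (L + 1) → TorusB n) :
    convOrbital x = (x 0).orbitalMeasure.mconv (convOrbital fun i => x i.succ) := by
  simp only [convOrbital, List.ofFn_succ, List.foldr_cons]

instance (x : TorusB n) : SFinite x.orbitalMeasure :=
  inferInstanceAs (SFinite ((SOdd.haar n).map _))

instance {L : ℕ} (x : Fin L → TorusB n) : SFinite (convOrbital x) := by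
  induction L with
  | zero => exact inferInstanceAs (SFinite (Measure.dirac 1))
  | succ L ih =>
    rw [convOrbital_succ]
    infer_instance

theorem exists_of_ae_convOrbital {L : ℕ} {x : Fin L → TorusB n} {P : SOdd n → Prop}
    (h : ∀ᵐ y ∂convOrbital x, P y) :
    ∃ g : Fin L → SOdd n, P (List.ofFn fun i => g i * (x i).toSO * (g i)⁻¹).prod := by
  induction L generalizing P with
  | zero =>
    refine ⟨Fin.elim0, ?_⟩
    rw [convOrbital, List.ofFn_zero, List.foldr_nil, ae_dirac_eq] at h
    simpa using h
  | succ L ih =>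
    rw [convOrbital_succ, Measure.mconv] at h
    have hprod := Measure.ae_ae_of_ae_prod (ae_of_ae_map (by fun_prop) h)
    obtain ⟨g₀, hg₀⟩ := (ae_of_ae_map (by fun_prop) hprod).exists
    obtain ⟨g, hg⟩ := ih hg₀
    exact ⟨Fin.cons g₀ g, by simpa [List.ofFn_succ] using hg⟩

theorem eigenCodim_conj (g y : SOdd n) (α : ℂ) :
    eigenCodim (complexMatrix (g * y * g⁻¹)) α = eigenCodim (complexMatrix y) α := by
  refine eigenCodim_eq_of_mul_eq_mul ((Group.isUnit g).map complexMatrix) ?_ α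
  rw [← map_mul, ← map_mul, inv_mul_cancel_right]

theorem IsAbsCont.le_sum_eigenCodim {L : ℕ} {x : Fin L → TorusB n} (hx : IsAbsCont x)
    (α : Fin L → ℂ) :
    2 * n + 1 ≤ ∑ i, eigenCodim (complexMatrix (x i).toSO) (α i) +
      if ∏ i, α i = 1 then 1 else 0 := by
  obtain ⟨g, hg⟩ := exists_of_ae_convOrbital (hx.ae_le (SOdd.ae_le_eigenCodim (∏ i, α i)))
  refine hg.trans (Nat.add_le_add_right ?_ _)
  rw [map_list_prod, List.map_ofFn]
  exact (eigenCodim_prod_ofFn_le _ α).trans_eq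
    (Finset.sum_congr rfl fun i _ => eigenCodim_conj (g i) _ _)

/-! ### Dominant eigenvalues -/

/-- The two dominant types that are not tied to a real eigenvalue: `BD` has a choice between `1` and
`-1`, and in type `S` the dominant eigenvalue is not real. -/
def IsExceptional (x : TorusB n) : Prop :=
  x.dominantType = .BD ∨ x.dominantType = .S

open Classical in
/-- The dominant eigenvalue of a non-exceptional `x`; exceptional elements get the neutral value
`1`. -/
def dominantSign (x : TorusB n) : ℂ := if x.dominantType = .D then -1 else 1

theorem IsExceptional.dominantSign_eq_one {x : TorusB n} (hx : x.IsExceptional) :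
    x.dominantSign = 1 :=
  if_neg fun h => by simp [IsExceptional, h] at hx

theorem parity_eq_one_or_two {L : ℕ} (x : Fin L → TorusB n) : parity x = 1 ∨ parity x = 2 := by
  rw [parity]
  exact ite_eq_or_eq _ 1 2

theorem prod_dominantSign {L : ℕ} (x : Fin L → TorusB n) :
    ∏ i, (x i).dominantSign = (-1) ^ parity x := by
  classical
  simp only [dominantSign]
  rw [Finset.prod_ite, Finset.prod_const, Finset.prod_const_one, mul_one, parity,
    Nat.card_eq_fintype_card, Fintype.card_subtype]
  split_ifs with h
  · rw [h.neg_one_pow, pow_one]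
  · rw [(Nat.not_odd_iff_even.1 h).neg_one_pow, neg_one_sq]

theorem bigS_add_eigenCodim_dominantSign_le {x : TorusB n} (hx : ¬x.IsExceptional) (p : ℕ) :
    x.bigS p + eigenCodim (complexMatrix x.toSO) x.dominantSign ≤ 2 * n + 1 := by
  rw [IsExceptional] at hx
  cases h : x.dominantType with
  | B => simpa [bigS, dominantSign, h] using x.two_mul_u_add_one_add_eigenCodim.le
  | D => simpa [bigS, dominantSign, h] using x.two_mul_v_add_eigenCodim.le
  | BD => exact absurd (Or.inl h) hx
  | S => exact absurd (Or.inr h) hx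

theorem IsExceptional.exists_bigS_add_eigenCodim_le {x : TorusB n} (hx : x.IsExceptional) {p : ℕ}
    (hp : p = 1 ∨ p = 2) :
    ∃ α : ℂ, α * (-1) ^ p ≠ 1 ∧ x.bigS p + eigenCodim (complexMatrix x.toSO) α ≤ 2 * n + 1 := by
  rcases hx with h | h
  · rcases hp with rfl | rfl
    · exact ⟨1, by norm_num, by simpa [bigS, h] using x.two_mul_u_add_one_add_eigenCodim.le⟩
    · exact ⟨-1, by norm_num, by simpa [bigS, h] using x.two_mul_v_add_eigenCodim.le⟩
  · obtain ⟨hs, -⟩ := (x.dominantType_eq_iff .S).1 h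
    obtain ⟨z, hz, hz1, hz2⟩ := exists_s_eq_mult (x := x) (by omega)
    refine ⟨z, ?_, by simpa [bigS, h, hz] using x.mult_add_eigenCodim_le z⟩
    rcases hp with rfl | rfl
    · rwa [pow_one, mul_neg_one, Ne, neg_eq_iff_eq_neg]
    · rwa [neg_one_sq, mul_one]

theorem IsAbsCont.sum_le {L : ℕ} {x : Fin L → TorusB n} (hx : IsAbsCont x) {S : Fin L → ℕ}
    {α : Fin L → ℂ} (hS : ∀ i, S i + eigenCodim (complexMatrix (x i).toSO) (α i) ≤ 2 * n + 1) :
    ∑ i, (S i : ℤ) ≤ (2 * n + 1) * ((L : ℤ) - 1) + if ∏ i, α i = 1 then 1 else 0 := by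
  have hsum := Finset.sum_le_card_nsmul Finset.univ _ _ fun i _ => hS i
  have hcodim := hx.le_sum_eigenCodim α
  rw [Finset.sum_add_distrib, Finset.card_univ, Fintype.card_fin, smul_eq_mul] at hsum
  zify at hsum hcodim
  linarith

theorem IsAbsCont.sum_bigS_le_of_isExceptional {L : ℕ} {x : Fin L → TorusB n} (hx : IsAbsCont x)
    {j : Fin L} (hj : (x j).IsExceptional) (hunique : ∀ i, (x i).IsExceptional → i = j) :
    ∑ i, ((x i).bigS (parity x) : ℤ) ≤ (2 * n + 1) * ((L : ℤ) - 1) := by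
  obtain ⟨β, hβ, hβS⟩ := hj.exists_bigS_add_eigenCodim_le (parity_eq_one_or_two x)
  let α : Fin L → ℂ := Function.update (fun i => (x i).dominantSign) j β
  have hprod : ∏ i, α i = β * (-1) ^ parity x := by
    rw [Finset.prod_update_of_mem (Finset.mem_univ j), Finset.sdiff_singleton_eq_erase,
      ← prod_dominantSign, ← Finset.mul_prod_erase _ _ (Finset.mem_univ j),
      hj.dominantSign_eq_one, one_mul]
  have hS (i : Fin L) :
      (x i).bigS (parity x) + eigenCodim (complexMatrix (x i).toSO) (α i) ≤ 2 * n + 1 := by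
    rcases eq_or_ne i j with rfl | hij
    · simpa [α] using hβS
    · simpa [α, hij] using bigS_add_eigenCodim_dominantSign_le (fun h => hij (hunique i h)) _
  simpa only [hprod, hβ, if_false, add_zero] using hx.sum_le hS

theorem IsAbsCont.sum_bigS_le_of_not_isExceptional {L : ℕ} {x : Fin L → TorusB n}
    (hx : IsAbsCont x) (h : ∀ i, ¬(x i).IsExceptional) :
    ∑ i, ((x i).bigS (parity x) : ℤ) ≤ (2 * n + 1) * ((L : ℤ) - 1) + parity x - 1 := by
  have hsum := hx.sum_le fun i => bigS_add_eigenCodim_dominantSign_le (h i) (parity x)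
  rw [prod_dominantSign] at hsum
  rcases parity_eq_one_or_two x with hp | hp <;> norm_num [hp] at hsum ⊢ <;> linarith

theorem existsUnique_dominantType_eq {L : ℕ} {x : Fin L → TorusB n} {j : Fin L}
    (hunique : ∀ i, (x i).IsExceptional → i = j) (hj : (x j).IsExceptional) :
    ((∃! i, (x i).dominantType = .S) ∧ ∀ i, (x i).dominantType ≠ .BD) ∨
      (∃! i, (x i).dominantType = .BD) ∧ ∀ i, (x i).dominantType ≠ .S := by
  grind [IsExceptional, ExistsUnique]

end TorusB

end

theorem mainTheorem2 (n : ℕ) (hn : 1 ≤ n) (L : ℕ) (x : Fin L → TorusB n)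
    (hx : TorusB.IsAbsCont x) : TorusB.Eligible x := by
  by_cases hnone : ∀ i, ¬(x i).IsExceptional
  · exact .inr <| .inr <| .inr
      ⟨fun i => not_or.1 (hnone i), hx.sum_bigS_le_of_not_isExceptional hnone⟩
  obtain ⟨j, hj⟩ := not_forall_not.1 hnone
  by_cases hunique : ∀ i, (x i).IsExceptional → i = j
  · have hle := hx.sum_bigS_le_of_isExceptional hj hunique
    rcases TorusB.existsUnique_dominantType_eq hunique hj with ⟨hS, hBD⟩ | ⟨hBD, hS⟩
    · exact .inr <| .inl ⟨hS, hBD, hle⟩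
    · exact .inr <| .inr <| .inl ⟨hBD, hS, hle⟩
  · push Not at hunique
    obtain ⟨i, hi, hij⟩ := hunique
    exact .inl ⟨i, j, hij, hi, hj⟩
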